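/- Let $\mathbb F\in\{\mathbb R,\mathbb C\}$, let $\mathcal H$ be a Hilbert space over $\mathbb F$ with inner product $\langle\cdot|\cdot\rangle$ linear in the second variable, and let $\mathscr B(\mathcal H)$ and $\mathscr K(\mathcal H)$ be the bounded and the compact linear operators on $\mathcal H$, with the operator norm. For $A\in\mathscr B(\mathcal H)$ let $\operatorname{dist}(A,\mathscr K(\mathcal H))=\inf\{\|A-K\|:K\in\mathscr K(\mathcal H)\}$, and let $$\partial\|A\|=\{f\in\mathscr B(\mathcal H)^* : \|B\|-\|A\|\ge\operatorname{Re}f(B-A)\ \text{ for all } B\in\mathscr B(\mathcal H)\}$$ be the subdifferential of the operator norm at $A$. For $u,v\in\mathcal H$ let $u\bar\otimes v$ be the operator $w\mapsto\langle v|w\rangle u$, which is identified with the bounded linear functional $B\mapsto\operatorname{tr}\big(B(u\bar\otimes v)\big)$ on $\mathscr B(\mathcal H)$. If $0\ne A\in\mathscr B(\mathcal H)$ satisfies $\operatorname{dist}(A,\mathscr K(\mathcal H))<\|A\|$, then $$\partial\|A\|=\overline{\operatorname{conv}}\{u\bar\otimes v : u,v\in\mathcal H,\ \|u\|=\|v\|=1,\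 Au=\|A\|v\},$$ where $\overline{\operatorname{conv}}$ is the closed convex hull in $\mathscr B(\mathcal H)^*$ with its norm topology. -/

import Mathlib

section SubdifferentialOfOperatorNorm

/-- The subdifferential `∂‖v‖` of the norm at `v`: the bounded linear functionals `f` with
`Re f (u - v) ≤ ‖u‖ - ‖v‖` for all `u`. -/
def normSubdifferential (𝕜 : Type*) [RCLike 𝕜] {V : Type*} [NormedAddCommGroup V]
    [NormedSpace 𝕜 V] (v : V) : Set (StrongDual 𝕜 V) :=
  {f | ∀ u : V, RCLike.re (f (u - v)) ≤ ‖u‖ - ‖v‖}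

/-- `HasTrace T t`: the operator `T` has trace `t`, that is, `∑ i, ⟪b i, T (b i)⟫ = t`
(unconditional convergence) for every orthonormal basis `b` of `H`. -/
def HasTrace {𝕜 : Type*} [RCLike 𝕜] {H : Type*} [NormedAddCommGroup H]
    [InnerProductSpace 𝕜 H] (T : H →L[𝕜] H) (t : 𝕜) : Prop :=
  ∀ (w : Set H) (b : HilbertBasis w 𝕜 H), HasSum (fun i => inner 𝕜 (b i) (T (b i))) t

/-- For the rank-one operator `rankOne 𝕜 u v : w ↦ ⟪v, w⟫ • u` and a bounded operator `B`,
`tr (B ∘ (u ⊗ v)) = ⟪v, B u⟫`. -/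
theorem hasTrace_comp_rankOne {𝕜 : Type*} [RCLike 𝕜] {H : Type*} [NormedAddCommGroup H]
    [InnerProductSpace 𝕜 H] (B : H →L[𝕜] H) (u v : H) :
    HasTrace (B ∘L InnerProductSpace.rankOne 𝕜 u v) (inner 𝕜 v (B u)) := by
  intro w b
  have h := b.hasSum_inner_mul_inner v (B u)
  simpa [inner_smul_right] using h

/-- A bounded operator determines the trace uniquely. -/
theorem HasTrace.unique {𝕜 : Type*} [RCLike 𝕜] {H : Type*} [NormedAddCommGroup H]
    [InnerProductSpace 𝕜 H] [CompleteSpace H] {T : H →L[𝕜] H} {s t : 𝕜}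
    (hs : HasTrace T s) (ht : HasTrace T t) : s = t := by
  obtain ⟨w, b, -⟩ := exists_hilbertBasis 𝕜 H
  exact (hs w b).unique (ht w b)

/-- The set of all `u ⊗ v` with `‖u‖ = ‖v‖ = 1` and `A u = ‖A‖ v`, where `u ⊗ v` is the rank-one
operator `w ↦ ⟪v, w⟫ • u`, and an operator `T` of finite rank is regarded as the bounded linear
functional `B ↦ tr (B T)` on the bounded operators. -/
def normingRankOne {𝕜 : Type*} [RCLike 𝕜] {H : Type*} [NormedAddCommGroup H]
    [InnerProductSpace 𝕜 H] (A : H →L[𝕜] H) : Set (StrongDual 𝕜 (H →L[𝕜] H)) :=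
  {f | ∃ u v : H, ‖u‖ = 1 ∧ ‖v‖ = 1 ∧ A u = (‖A‖ : 𝕜) • v ∧
    ∀ B : H →L[𝕜] H, HasTrace (B ∘L InnerProductSpace.rankOne 𝕜 u v) (f B)}

end SubdifferentialOfOperatorNorm

open Filter Topology

/-! One inclusion is direct, the subdifferential being closed and convex. For the other, a compact
`K` with `‖A - K‖ < ‖A‖` forces near-norming vectors of `A` to accumulate in norm
(`exists_tendsto_subseq_of_tendsto_norm_apply`). Hence the generating functionals form a
norm-compact set, and a subgradient outside their closed convex hull is strictly separated from it
by evaluation at some operator `B`. The subgradient bounds from below the growth of the norm from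
`A` in direction `B`; near-maximizers for `A + tB` converge, as `t → 0`, to a norming vector of `A`
that realizes this growth, contradicting the separation. -/

instance WeakDual.isScalarTower_real {𝕜 : Type*} [RCLike 𝕜] {V : Type*} [NormedAddCommGroup V]
    [NormedSpace 𝕜 V] : IsScalarTower ℝ 𝕜 (WeakDual 𝕜 V) :=
  inferInstanceAs (IsScalarTower ℝ 𝕜 (V →L[𝕜] 𝕜))

instance WeakDual.locallyConvexSpace_real {𝕜 : Type*} [RCLike 𝕜] {V : Type*}
    [NormedAddCommGroup V] [NormedSpace 𝕜 V] : LocallyConvexSpace ℝ (WeakDual 𝕜 V) :=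
  inferInstanceAs (LocallyConvexSpace ℝ (WeakBilin (topDualPairing 𝕜 V)))

theorem WeakDual.exists_re_dual_apply_lt {𝕜 : Type*} [RCLike 𝕜] {V : Type*}
    [NormedAddCommGroup V] [NormedSpace 𝕜 V] {S : Set (WeakDual 𝕜 V)} (hconv : Convex ℝ S)
    (hcl : IsClosed S) {f : WeakDual 𝕜 V} (hf : f ∉ S) :
    ∃ (φ : StrongDual 𝕜 (WeakDual 𝕜 V)) (r : ℝ),
      (∀ g ∈ S, RCLike.re (φ g) < r) ∧ r < RCLike.re (φ f) := by
  have hsep : ∃ (φ : StrongDual ℝ (WeakDual 𝕜 V)) (r : ℝ), (∀ g ∈ S, φ g < r) ∧ r < φ f :=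
    geometric_hahn_banach_closed_point hconv hcl hf
  obtain ⟨φ, r, h⟩ := hsep
  -- The `𝕜`-linear extension of `φ` has real part `φ`.
  exact ⟨φ.extendRCLikeₗ, r, by simpa [φ.extendRCLikeₗ_apply] using h⟩

theorem WeakDual.exists_eq_eval {𝕜 : Type*} [RCLike 𝕜] {V : Type*} [NormedAddCommGroup V]
    [NormedSpace 𝕜 V] (φ : StrongDual 𝕜 (WeakDual 𝕜 V)) :
    ∃ x : V, ∀ g : WeakDual 𝕜 V, φ g = g x := by
  obtain ⟨x, hx⟩ := LinearMap.dualEmbedding_surjective (topDualPairing 𝕜 V) φ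
  exact ⟨x, fun g => (DFunLike.congr_fun hx g).symm⟩

/-- Hahn–Banach separation in the weak-* topology, by evaluation at a vector. -/
theorem WeakDual.exists_re_apply_lt {𝕜 : Type*} [RCLike 𝕜] {V : Type*} [NormedAddCommGroup V]
    [NormedSpace 𝕜 V] {S : Set (WeakDual 𝕜 V)} (hconv : Convex ℝ S) (hcl : IsClosed S)
    {f : WeakDual 𝕜 V} (hf : f ∉ S) :
    ∃ (x : V) (r : ℝ), (∀ g ∈ S, RCLike.re (g x) < r) ∧ r < RCLike.re (f x) := by
  obtain ⟨φ, r, h1, h2⟩ := WeakDual.exists_re_dual_apply_lt hconv hcl hf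
  obtain ⟨x, hx⟩ := WeakDual.exists_eq_eval φ
  exact ⟨x, r, fun g hg => hx g ▸ h1 g hg, hx f ▸ h2⟩

/-- The norm-closed convex hull of a norm-compact set in the dual is weak-* closed, so a functional
outside it is separated from it by evaluation at a vector. -/
theorem exists_re_apply_lt_of_notMem_closedConvexHull {𝕜 : Type*} [RCLike 𝕜] {V : Type*}
    [NormedAddCommGroup V] [NormedSpace 𝕜 V] {C : Set (StrongDual 𝕜 V)} (hC : IsCompact C)
    {f : StrongDual 𝕜 V} (hf : f ∉ closedConvexHull ℝ C) :
    ∃ (x : V) (r : ℝ), (∀ g ∈ C, RCLike.re (g x) < r) ∧ r < RCLike.re (f x) := by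
  have hK : IsCompact (closedConvexHull ℝ C) := by
    rw [closedConvexHull_eq_closure_convexHull]
    -- Completeness of the dual turns total boundedness into compactness, which passes to the weaker
    -- weak-* topology.
    exact hC.totallyBounded.convexHull.closure.isCompact_of_isClosed isClosed_closure
  have hcl : IsClosed (StrongDual.toWeakDual '' (closedConvexHull ℝ C : Set (StrongDual 𝕜 V))) :=
    (hK.image NormedSpace.Dual.toWeakDual_continuous).isClosed
  have hconv : Convex ℝ
      (StrongDual.toWeakDual '' (closedConvexHull ℝ C : Set (StrongDual 𝕜 V))) := by
    rintro _ ⟨g, hg, rfl⟩ _ ⟨h, hh, rfl⟩ a b ha hb hab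
    exact ⟨a • g + b • h, convex_closedConvexHull hg hh ha hb hab, rfl⟩
  have hf' : StrongDual.toWeakDual f ∉
      StrongDual.toWeakDual '' (closedConvexHull ℝ C : Set (StrongDual 𝕜 V)) := by
    rintro ⟨g, hg, hgf⟩
    exact hf (StrongDual.toWeakDual.injective hgf ▸ hg)
  obtain ⟨x, r, h1, h2⟩ := WeakDual.exists_re_apply_lt hconv hcl hf'
  exact ⟨x, r, fun g hg => h1 _ ⟨g, subset_closedConvexHull hg, rfl⟩, h2⟩

section

variable {𝕜 : Type*} [RCLike 𝕜] {H : Type*} [NormedAddCommGroup H] [InnerProductSpace 𝕜 H]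

/-- Expand the square. Thus near-norming vectors are approximate eigenvectors of `A* A` for the
eigenvalue `‖A‖ ^ 2`. -/
theorem norm_adjoint_apply_sub_sq_le [CompleteSpace H] (A : H →L[𝕜] H) {x : H} (hx : ‖x‖ ≤ 1) :
    ‖A.adjoint (A x) - ((‖A‖ ^ 2 : ℝ) : 𝕜) • x‖ ^ 2 ≤ ‖A‖ ^ 2 * (‖A‖ ^ 2 - ‖A x‖ ^ 2) := by
  have h1 : ‖A.adjoint (A x)‖ ≤ ‖A‖ * ‖A x‖ := by
    simpa using A.adjoint.le_opNorm (A x)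
  have h2 : RCLike.re (inner 𝕜 (A.adjoint (A x)) (((‖A‖ ^ 2 : ℝ) : 𝕜) • x))
      = ‖A‖ ^ 2 * ‖A x‖ ^ 2 := by
    rw [inner_smul_right, ContinuousLinearMap.adjoint_inner_left, RCLike.re_ofReal_mul,
      inner_self_eq_norm_sq]
  have h3 : ‖((‖A‖ ^ 2 : ℝ) : 𝕜) • x‖ ≤ ‖A‖ ^ 2 := by
    rw [norm_smul, RCLike.norm_ofReal, abs_of_nonneg (sq_nonneg _)]
    exact mul_le_of_le_one_right (sq_nonneg _) hx
  have h4 := pow_le_pow_left₀ (norm_nonneg _) h1 2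
  have h5 := pow_le_pow_left₀ (norm_nonneg _) h3 2
  rw [@norm_sub_sq 𝕜, h2]
  nlinarith

/-- If `A` is closer than `‖A‖` to a compact operator, then every sequence in the unit ball along
which `‖A x‖` tends to `‖A‖` has a convergent subsequence. -/
theorem exists_tendsto_subseq_of_tendsto_norm_apply [CompleteSpace H] {A K : H →L[𝕜] H}
    (hK : IsCompactOperator K) (hAK : ‖A - K‖ < ‖A‖) {x : ℕ → H} (hx : ∀ n, ‖x n‖ ≤ 1)
    (hAx : Tendsto (fun n => ‖A (x n)‖) atTop (𝓝 ‖A‖)) :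
    ∃ (u : H) (φ : ℕ → ℕ), StrictMono φ ∧ Tendsto (x ∘ φ) atTop (𝓝 u) ∧
      ‖u‖ = 1 ∧ ‖A u‖ = ‖A‖ := by
  have ha : 0 < ‖A‖ := (norm_nonneg _).trans_lt hAK
  obtain ⟨Q, hQ, hQK⟩ := hK.image_closedBall_subset_compact (f := K.toLinearMap) 1
  obtain ⟨y, -, φ, hφ, hy⟩ := hQ.tendsto_subseq (x := fun n => K (x n))
    (fun n => hQK ⟨x n, by simpa using hx n, rfl⟩)
  have hres : Tendsto (fun n => A.adjoint (A (x n)) - ((‖A‖ ^ 2 : ℝ) : 𝕜) • x n) atTop (𝓝 0) := by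
    have hz : Tendsto (fun n => ‖A‖ ^ 2 * (‖A‖ ^ 2 - ‖A (x n)‖ ^ 2)) atTop (𝓝 0) := by
      have := ((hAx.pow 2).const_sub (‖A‖ ^ 2)).const_mul (‖A‖ ^ 2)
      simpa using this
    have hsq := squeeze_zero (fun n => sq_nonneg _)
      (fun n => norm_adjoint_apply_sub_sq_le A (hx n)) hz
    rw [tendsto_zero_iff_norm_tendsto_zero]
    simpa using hsq.sqrt
  -- `T x` is the eigenvector residual of `x` minus `A* K x`, so it converges along `φ`. Since `‖A*
  -- (A - K)‖ ≤ ‖A‖ * ‖A - K‖ < ‖A‖ ^ 2`, `T` is bounded below, which makes the vectors themselves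
  -- Cauchy.
  set T : H →L[𝕜] H := A.adjoint ∘L (A - K) - ((‖A‖ ^ 2 : ℝ) : 𝕜) • ContinuousLinearMap.id 𝕜 H
    with hT
  have hlim : Tendsto (fun n => T (x (φ n))) atTop (𝓝 (0 - A.adjoint y)) := by
    refine ((hres.comp hφ.tendsto_atTop).sub
      ((A.adjoint.continuous.tendsto y).comp hy)).congr fun n => ?_
    simp [hT]
    abel
  set c : ℝ := ‖A‖ * (‖A‖ - ‖A - K‖) with hc
  have hcpos : 0 < c := mul_pos ha (sub_pos.2 hAK)
  have hbelow : ∀ z, c * ‖z‖ ≤ ‖T z‖ := by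
    intro z
    have h1 : ‖((‖A‖ ^ 2 : ℝ) : 𝕜) • z‖ = ‖A‖ ^ 2 * ‖z‖ := by
      rw [norm_smul, RCLike.norm_ofReal, abs_of_nonneg (sq_nonneg _)]
    have h2 : ‖A.adjoint ((A - K) z)‖ ≤ ‖A‖ * (‖A - K‖ * ‖z‖) := by
      refine (A.adjoint.le_opNorm _).trans ?_
      rw [LinearIsometryEquiv.norm_map]
      gcongr
      exact (A - K).le_opNorm z
    have h3 : ‖((‖A‖ ^ 2 : ℝ) : 𝕜) • z‖ - ‖A.adjoint ((A - K) z)‖ ≤ ‖T z‖ := by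
      rw [← norm_neg (T z)]
      refine (norm_sub_norm_le _ _).trans (le_of_eq ?_)
      simp [hT]
    rw [hc]
    linarith
  have hcauchy : CauchySeq (x ∘ φ) := by
    have hC := Metric.cauchySeq_iff'.1 hlim.cauchySeq
    refine Metric.cauchySeq_iff'.2 fun ε hε => ?_
    obtain ⟨N, hN⟩ := hC (c * ε) (mul_pos hcpos hε)
    refine ⟨N, fun n hn => ?_⟩
    have h1 := hN n hn
    have h2 := hbelow (x (φ n) - x (φ N))
    rw [dist_eq_norm, ← map_sub] at h1
    rw [dist_eq_norm]
    exact lt_of_mul_lt_mul_left (h2.trans_lt h1) hcpos.le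
  obtain ⟨u, hu⟩ := cauchySeq_tendsto_of_complete hcauchy
  have hu1 : ‖u‖ ≤ 1 := le_of_tendsto' hu.norm fun n => hx _
  have hAu : ‖A u‖ = ‖A‖ :=
    tendsto_nhds_unique ((A.continuous.tendsto u).comp hu).norm (hAx.comp hφ.tendsto_atTop)
  refine ⟨u, φ, hφ, hu, le_antisymm hu1 ?_, hAu⟩
  have := A.le_opNorm u
  rw [hAu] at this
  exact le_of_mul_le_mul_left (by simpa using this) ha

/-- The functional `B ↦ ⟪v, B u⟫`. -/
noncomputable def matrixCoeff (u v : H) : StrongDual 𝕜 (H →L[𝕜] H) :=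
  (innerSL 𝕜 v) ∘L (ContinuousLinearMap.apply 𝕜 H u)

@[simp]
theorem matrixCoeff_apply (u v : H) (B : H →L[𝕜] H) :
    matrixCoeff u v B = inner 𝕜 v (B u) := rfl

theorem continuous_matrixCoeff : Continuous fun p : H × H =>
    (matrixCoeff p.1 p.2 : StrongDual 𝕜 (H →L[𝕜] H)) :=
  (((innerSL 𝕜).continuous.comp continuous_snd)).clm_comp
    ((ContinuousLinearMap.apply 𝕜 H).continuous.comp continuous_fst)

/-- The equation `A u = ‖A‖ v` determines `v`, so compactness only has to be checked on the norming
unit vectors `u`. -/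
theorem normingRankOne_eq_image [CompleteSpace H] {A : H →L[𝕜] H} (hA : A ≠ 0) :
    normingRankOne A = (fun u => matrixCoeff u ((‖A‖ : 𝕜)⁻¹ • A u)) ''
      {u | ‖u‖ = 1 ∧ ‖A u‖ = ‖A‖} := by
  have ha : ‖A‖ ≠ 0 := norm_ne_zero_iff.2 hA
  have ha' : (‖A‖ : 𝕜) ≠ 0 := RCLike.ofReal_ne_zero.2 ha
  ext f
  constructor
  · rintro ⟨u, v, hu, hv, huv, hf⟩
    refine ⟨u, ⟨hu, by simp [huv, norm_smul, hv]⟩, ?_⟩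
    ext B
    simp only [huv, inv_smul_smul₀ ha', matrixCoeff_apply]
    exact (hasTrace_comp_rankOne B u v).unique (hf B)
  · rintro ⟨u, ⟨hu, hAu⟩, rfl⟩
    refine ⟨u, (‖A‖ : 𝕜)⁻¹ • A u, hu, by simp [norm_smul, hAu, ha], by
      rw [smul_inv_smul₀ ha'], fun B => hasTrace_comp_rankOne B _ _⟩

theorem isCompact_normingRankOne [CompleteSpace H] {A K : H →L[𝕜] H}
    (hK : IsCompactOperator K) (hAK : ‖A - K‖ < ‖A‖) : IsCompact (normingRankOne A) := by
  have ha : 0 < ‖A‖ := (norm_nonneg _).trans_lt hAK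
  rw [normingRankOne_eq_image (norm_pos_iff.1 ha)]
  refine IsCompact.image (IsSeqCompact.isCompact fun x hx => ?_) ?_
  · obtain ⟨u, φ, hφ, hu, h1, h2⟩ := exists_tendsto_subseq_of_tendsto_norm_apply hK hAK
      (fun n => (hx n).1.le) (by simp [(hx _).2])
    exact ⟨u, ⟨h1, h2⟩, φ, hφ, hu⟩
  · exact continuous_matrixCoeff.comp
      (continuous_id.prodMk (A.continuous.const_smul ((‖A‖ : 𝕜)⁻¹)))

theorem convex_normSubdifferential {V : Type*} [NormedAddCommGroup V] [NormedSpace 𝕜 V] (v : V) :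
    Convex ℝ (normSubdifferential 𝕜 v) := by
  intro f hf g hg a b ha hb hab w
  have h1 := mul_le_mul_of_nonneg_left (hf w) ha
  have h2 := mul_le_mul_of_nonneg_left (hg w) hb
  have h3 : a * (‖w‖ - ‖v‖) + b * (‖w‖ - ‖v‖) = ‖w‖ - ‖v‖ := by rw [← add_mul, hab, one_mul]
  rw [add_apply, smul_apply, smul_apply, map_add, RCLike.smul_re, RCLike.smul_re]
  linarith

theorem isClosed_normSubdifferential {V : Type*} [NormedAddCommGroup V] [NormedSpace 𝕜 V] (v : V) :
    IsClosed (normSubdifferential 𝕜 v) := by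
  simp only [normSubdifferential, Set.ofPred_forall]
  refine isClosed_iInter fun w => isClosed_le ?_ continuous_const
  exact RCLike.continuous_re.comp (ContinuousLinearMap.apply 𝕜 𝕜 (w - v)).continuous

theorem normingRankOne_subset_normSubdifferential [CompleteSpace H] (A : H →L[𝕜] H) :
    normingRankOne A ⊆ normSubdifferential 𝕜 A := by
  rintro f ⟨u, v, hu, hv, huv, hf⟩ B
  have h : ∀ B, f B = inner 𝕜 v (B u) := fun B =>
    (hf B).unique (hasTrace_comp_rankOne B u v)
  have h1 : RCLike.re (inner 𝕜 v (B u)) ≤ ‖B‖ := by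
    refine (RCLike.re_le_norm _).trans ((norm_inner_le_norm _ _).trans ?_)
    simpa [hu, hv] using B.le_opNorm u
  have h2 : RCLike.re (inner 𝕜 v (A u)) = ‖A‖ := by
    rw [huv, inner_smul_right, RCLike.re_ofReal_mul, inner_self_eq_norm_sq, hv]
    simp
  rw [map_sub, map_sub, h, h, h2]
  linarith

/-- A strict lower bound, along small `t > 0`, for the difference quotients of the norm at `A` in
direction `B` is attained, up to equality, by a norming vector of `A`. -/
theorem exists_le_re_inner_of_add_mul_lt_norm_add_smul [CompleteSpace H] {A K : H →L[𝕜] H}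
    (hK : IsCompactOperator K) (hAK : ‖A - K‖ < ‖A‖) (B : H →L[𝕜] H) {r : ℝ}
    (hr : ∀ t : ℝ, 0 < t → ‖A‖ + t * r < ‖A + (t : 𝕜) • B‖) :
    ∃ u : H, ‖u‖ = 1 ∧ ‖A u‖ = ‖A‖ ∧ ‖A‖ * r ≤ RCLike.re (inner 𝕜 (A u) (B u)) := by
  have ha : 0 < ‖A‖ := (norm_nonneg _).trans_lt hAK
  set t : ℕ → ℝ := fun n => 1 / ((n : ℝ) + 1)
  have ht : ∀ n, 0 < t n := fun n => Nat.one_div_pos_of_nat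
  have ht0 : Tendsto t atTop (𝓝 0) := tendsto_one_div_add_atTop_nhds_zero_nat
  choose x hx hxr using fun n =>
    (A + (t n : 𝕜) • B).exists_lt_apply_of_lt_opNorm (hr (t n) (ht n))
  have hBx : ∀ n, ‖B (x n)‖ ≤ ‖B‖ := fun n => B.unit_le_opNorm _ (hx n).le
  have hAx' : ∀ n, ‖A (x n)‖ ≤ ‖A‖ := fun n => A.unit_le_opNorm _ (hx n).le
  have htB : ∀ n, ‖(t n : 𝕜) • B (x n)‖ ≤ t n * ‖B‖ := fun n => by
    rw [norm_smul, RCLike.norm_ofReal, abs_of_pos (ht n)]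
    exact mul_le_mul_of_nonneg_left (hBx n) (ht n).le
  have hAx : Tendsto (fun n => ‖A (x n)‖) atTop (𝓝 ‖A‖) := by
    have hlow : Tendsto (fun n => ‖A‖ + t n * (r - ‖B‖)) atTop (𝓝 ‖A‖) := by
      simpa using (ht0.mul_const (r - ‖B‖)).const_add ‖A‖
    refine tendsto_of_tendsto_of_tendsto_of_le_of_le hlow tendsto_const_nhds (fun n => ?_) hAx'
    have h1 : ‖A‖ + t n * r < ‖A (x n) + (t n : 𝕜) • B (x n)‖ := hxr n
    have h2 := norm_add_le (A (x n)) ((t n : 𝕜) • B (x n))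
    have h3 := htB n
    show ‖A‖ + t n * (r - ‖B‖) ≤ ‖A (x n)‖
    linarith
  obtain ⟨u, φ, hφ, hu, hu1, hAu⟩ :=
    exists_tendsto_subseq_of_tendsto_norm_apply hK hAK (fun n => (hx n).le) hAx
  refine ⟨u, hu1, hAu, ?_⟩
  have htφ : Tendsto (fun n => t (φ n)) atTop (𝓝 0) := ht0.comp hφ.tendsto_atTop
  have hleft : Tendsto (fun n => 2 * ‖A‖ * r + t (φ n) * r ^ 2) atTop (𝓝 (2 * ‖A‖ * r)) := by
    simpa using (htφ.mul_const (r ^ 2)).const_add (2 * ‖A‖ * r)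
  have hright : Tendsto (fun n => 2 * RCLike.re (inner 𝕜 (A (x (φ n))) (B (x (φ n))))
      + t (φ n) * ‖B‖ ^ 2) atTop (𝓝 (2 * RCLike.re (inner 𝕜 (A u) (B u)))) := by
    have h1 : Tendsto (fun n => inner 𝕜 (A (x (φ n))) (B (x (φ n)))) atTop
        (𝓝 (inner 𝕜 (A u) (B u))) :=
      ((A.continuous.tendsto u).comp hu).inner ((B.continuous.tendsto u).comp hu)
    simpa using (((RCLike.continuous_re.tendsto _).comp h1).const_mul 2).add
      (htφ.mul_const (‖B‖ ^ 2))
  -- `r` may be negative, so positivity is needed before squaring.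
  have hpos : ∀ᶠ n in atTop, 0 < ‖A‖ + t (φ n) * r := by
    have h1 : Tendsto (fun n => ‖A‖ + t (φ n) * r) atTop (𝓝 ‖A‖) := by
      simpa using (htφ.mul_const r).const_add ‖A‖
    exact h1.eventually_const_lt ha
  have hle := le_of_tendsto_of_tendsto hleft hright <| by
    filter_upwards [hpos] with n hn
    have h1 : ‖A‖ + t (φ n) * r < ‖A (x (φ n)) + (t (φ n) : 𝕜) • B (x (φ n))‖ := hxr _
    have h2 := pow_le_pow_left₀ hn.le h1.le 2
    rw [@norm_add_sq 𝕜, inner_smul_right, RCLike.re_ofReal_mul] at h2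
    have h3 := pow_le_pow_left₀ (norm_nonneg _) (htB (φ n)) 2
    have h4 := pow_le_pow_left₀ (norm_nonneg _) (hAx' (φ n)) 2
    -- After squaring, the `‖A‖ ^ 2` terms cancel and every remaining term carries a factor `t`.
    refine le_of_mul_le_mul_left ?_ (ht (φ n))
    linarith
  linarith

end

theorem mainTheorem6 {𝕜 : Type*} [RCLike 𝕜] {H : Type*} [NormedAddCommGroup H]
    [InnerProductSpace 𝕜 H] [CompleteSpace H] (A : H →L[𝕜] H) (hA : A ≠ 0)
    (hdist : Metric.infDist A {K : H →L[𝕜] H | IsCompactOperator K} < ‖A‖) :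
    normSubdifferential 𝕜 A = closedConvexHull ℝ (normingRankOne A) := by
  obtain ⟨K, hK, hAK⟩ := (Metric.infDist_lt_iff ⟨0, isCompactOperator_zero⟩).1 hdist
  rw [dist_eq_norm] at hAK
  refine Set.Subset.antisymm (fun f hf => ?_) (closedConvexHull_min
    (normingRankOne_subset_normSubdifferential A) (convex_normSubdifferential A)
    (isClosed_normSubdifferential A))
  by_contra hfC
  obtain ⟨B, r, hC, hfB⟩ := exists_re_apply_lt_of_notMem_closedConvexHull
    (isCompact_normingRankOne hK hAK) hfC
  obtain ⟨u, hu, hAu, hle⟩ := exists_le_re_inner_of_add_mul_lt_norm_add_smul hK hAK B (r := r) <| by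
    intro t ht
    -- The subgradient inequality at `A + tB` gives growth at least `t * re (f B)`, and `r < re (f
    -- B)`.
    have h1 := hf (A + (t : 𝕜) • B)
    rw [add_sub_cancel_left, map_smul, smul_eq_mul, RCLike.re_ofReal_mul] at h1
    have h2 := mul_lt_mul_of_pos_left hfB ht
    linarith
  have hmem : matrixCoeff u ((‖A‖ : 𝕜)⁻¹ • A u) ∈ normingRankOne A := by
    rw [normingRankOne_eq_image hA]
    exact ⟨u, ⟨hu, hAu⟩, rfl⟩
  have hlt := hC _ hmem
  have ha : 0 < ‖A‖ := norm_pos_iff.2 hA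
  rw [matrixCoeff_apply, inner_smul_left, ← RCLike.ofReal_inv, RCLike.conj_ofReal,
    RCLike.re_ofReal_mul, inv_mul_lt_iff₀ ha] at hlt
  exact hlt.not_ge hle
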